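/- Let $\mathbb{R}_\ell$ be the Sorgenfrey line, i.e. the set of real numbers with the topology generated by the half-open intervals $[a,b[$, $a<b$. Let $\mathcal{Q}(\mathbb{R}_\ell)$ be its Smyth powerdomain, i.e. the set of all non-empty compact saturated subsets of $\mathbb{R}_\ell$ (a set is saturated if it is the intersection of its open neighborhoods), ordered by reverse inclusion $\supseteq$. Then $\mathcal{Q}(\mathbb{R}_\ell)$ with its Scott topology is not core-compact. Here the Scott-open sets are the upward closed sets $\mathcal{U}$ such that every non-empty directed family whose supremum exists and lies in $\mathcal{U}$ has a member in $\mathcal{U}$. A topological space is core-compact if for every point $x$ and every open neighborhood $U$ of $x$ there is an open neighborhood $V$ of $x$ such that every open cover of $U$ has a finite subfamily covering $V$ (equivalently, if its lattice of open sets is a continuous lattice). -/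

import Mathlib

/-- The Sorgenfrey line: the set of real numbers, to be equipped with the topology generated by
the half-open intervals `[a, b[`. It is a type synonym, so that the usual topology of `ℝ` does
not interfere. -/
def SorgenfreyLine : Type := ℝ

/-- The topology of the Sorgenfrey line, generated by the intervals `[a, b[` with `a < b`. -/
instance SorgenfreyLine.instTopologicalSpace : TopologicalSpace SorgenfreyLine :=
  TopologicalSpace.generateFrom {s : Set ℝ | ∃ a b : ℝ, a < b ∧ s = Set.Ico a b}

/-- A subset of a topological space is saturated if it is the intersection of its open
neighborhoods. -/
def IsSaturatedSet {X : Type*} [TopologicalSpace X] (s : Set X) : Prop :=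
  s = ⋂₀ {U : Set X | IsOpen U ∧ s ⊆ U}

/-- The Smyth powerdomain of a topological space: its non-empty compact saturated subsets. -/
@[ext]
structure SmythPowerdomain (X : Type*) [TopologicalSpace X] where
  carrier : Set X
  nonempty : carrier.Nonempty
  isCompact : IsCompact carrier
  isSaturated : IsSaturatedSet carrier

/-- The Smyth powerdomain is ordered by reverse inclusion. -/
instance SmythPowerdomain.instPartialOrder (X : Type*) [TopologicalSpace X] :
    PartialOrder (SmythPowerdomain X) where
  le P Q := Q.carrier ⊆ P.carrier
  le_refl _ := subset_rfl
  le_trans _ _ _ h₁ h₂ := h₂.trans h₁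
  le_antisymm _ _ h₁ h₂ := SmythPowerdomain.ext (h₂.antisymm h₁)

/-- `V` is way below `U` in the lattice of open sets: every open cover of `U` contains a finite
subfamily that covers `V`. -/
def OpenWayBelow {X : Type*} [TopologicalSpace X] (V U : Set X) : Prop :=
  ∀ C : Set (Set X), (∀ W ∈ C, IsOpen W) → U ⊆ ⋃₀ C →
    ∃ F : Set (Set X), F ⊆ C ∧ F.Finite ∧ V ⊆ ⋃₀ F

/-- A topological space is core-compact if every open neighborhood `U` of every point `x` contains
an open neighborhood of `x` that is way below `U`; equivalently, if its lattice of open sets is a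
continuous lattice. -/
def IsCoreCompactSpace (X : Type*) [TopologicalSpace X] : Prop :=
  ∀ (x : X) (U : Set X), IsOpen U → x ∈ U →
    ∃ V : Set X, IsOpen V ∧ x ∈ V ∧ OpenWayBelow V U

open Set Filter Topology

/-! Core-compactness of the powerdomain would force local compactness. Take a Scott-open
neighborhood `V` of `{x}` way below the whole space; by first countability, `V` contains all
non-empty compact subsets of some neighborhood `U` of `x`. If `x` had no compact neighborhood, every
compact set would miss a point of `U`, so the Scott-open sets of all `K` avoiding `y`, for `y ∈ U`,
would form a cover. Finitely many points `T ⊆ U` would then suffice for `V`, yet `T ∪ {x}` lies in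
`V` and avoids no point of `T`. The Sorgenfrey line has no compact neighborhoods. -/

section Compact

/-- A point together with a sequence of compact sets that converges to it is compact. -/
theorem isCompact_insert_iUnion_of_tendsto {X : Type*} [TopologicalSpace X] {x : X}
    {K : ℕ → Set X} (hK : ∀ n, IsCompact (K n)) (h : ∀ U ∈ 𝓝 x, ∃ N, ∀ n ≥ N, K n ⊆ U) :
    IsCompact (insert x (⋃ n, K n)) := by
  rw [isCompact_iff_ultrafilter_le_nhds]
  intro f hf
  by_cases hm : ∃ n, K n ∈ f
  · obtain ⟨n, hn⟩ := hm
    obtain ⟨y, hy, hfy⟩ := isCompact_iff_ultrafilter_le_nhds.1 (hK n) f (le_principal_iff.2 hn)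
    exact ⟨y, mem_insert_of_mem _ (mem_iUnion_of_mem n hy), hfy⟩
  · push Not at hm
    refine ⟨x, mem_insert _ _, fun U hU ↦ ?_⟩
    obtain ⟨N, hN⟩ := h U hU
    -- The ultrafilter contains no `K n`, so it ignores the finitely many that may leave `U`.
    have hfin : ⋂ n ∈ Finset.range N, (K n)ᶜ ∈ (f : Filter X) :=
      (Filter.biInter_finset_mem _).2 fun n _ ↦ Ultrafilter.compl_mem_iff_notMem.2 (hm n)
    filter_upwards [le_principal_iff.1 hf, hfin] with y hy hyN
    rcases hy with rfl | hy
    · exact mem_of_mem_nhds hU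
    · obtain ⟨n, hn⟩ := mem_iUnion.1 hy
      refine hN n (not_lt.1 fun hlt ↦ ?_) hn
      exact mem_iInter₂.1 hyN n (Finset.mem_range.2 hlt) hn

end Compact

section Smyth

variable {X : Type*} [TopologicalSpace X]

theorem isSaturatedSet_of_t1Space [T1Space X] (s : Set X) : IsSaturatedSet s := by
  refine (subset_sInter fun U hU ↦ hU.2).antisymm fun x hx ↦ by_contra fun hxs ↦ ?_
  exact hx {x}ᶜ ⟨isOpen_compl_singleton, subset_compl_singleton_iff.2 hxs⟩ rfl

/-- A non-empty compact subset of a T₁ space, as an element of the Smyth powerdomain. -/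
def SmythPowerdomain.ofIsCompact [T1Space X] (s : Set X) (hne : s.Nonempty) (hs : IsCompact s) :
    SmythPowerdomain X :=
  ⟨s, hne, hs, isSaturatedSet_of_t1Space s⟩

/-- In a Hausdorff space, the directed suprema of the Smyth powerdomain are intersections. -/
theorem SmythPowerdomain.carrier_eq_iInter_of_isLUB [T2Space X] {D : Set (SmythPowerdomain X)}
    (hne : D.Nonempty) (hD : DirectedOn (· ≤ ·) D) {K : SmythPowerdomain X} (hK : IsLUB D K) :
    K.carrier = ⋂ d : D, d.1.carrier := by
  have : Nonempty D := hne.to_subtype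
  have hdir : Directed (· ⊇ ·) fun d : D ↦ d.1.carrier := hD.directed_val
  have hcl (d : D) : IsClosed d.1.carrier := d.1.isCompact.isClosed
  have hI := IsCompact.nonempty_iInter_of_directed_nonempty_isCompact_isClosed _ hdir
    (fun d ↦ d.1.nonempty) (fun d ↦ d.1.isCompact) hcl
  obtain ⟨d₀⟩ := ‹Nonempty D›
  have hc : IsCompact (⋂ d : D, d.1.carrier) :=
    d₀.1.isCompact.of_isClosed_subset (isClosed_iInter hcl) (iInter_subset _ d₀)
  refine (subset_iInter fun d ↦ hK.1 d.2).antisymm ?_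
  exact hK.2 (show ofIsCompact _ hI hc ∈ upperBounds D from
    fun d hd ↦ iInter_subset (fun d : D ↦ d.1.carrier) ⟨d, hd⟩)

/-- In a Hausdorff space, a set of compact sets that is the basic open set of the upper Vietoris
topology given by an open set `U` is Scott-open. -/
theorem SmythPowerdomain.isOpen_setOf_carrier_subset [T2Space X] {U : Set X} (hU : IsOpen U) :
    IsOpen {K : WithScott (SmythPowerdomain X) | (WithScott.ofScott K).carrier ⊆ U} := by
  rw [IsScott.isOpen_iff_isUpperSet_and_dirSupInaccOn (D := univ), dirSupInaccOn_univ]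
  refine ⟨fun K L hKL hK ↦ Subset.trans hKL hK, fun D hne hD K hlub hK ↦ ?_⟩
  have : Nonempty D := hne.to_subtype
  have heq := carrier_eq_iInter_of_isLUB (X := X) hne hD hlub
  have hdir : Directed (· ⊇ ·) fun d : D ↦ (WithScott.ofScott d.1).carrier := hD.directed_val
  obtain ⟨d, hd⟩ := exists_subset_nhds_of_isCompact hdir
    (fun d ↦ (WithScott.ofScott d.1).isCompact) (U := U)
    fun x hx ↦ hU.mem_nhds (hK (heq.symm.subset hx))
  exact ⟨d, d.2, hd⟩

/-- In a first-countable Hausdorff space, a Scott-open set that contains a singleton `{x}` contains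
all non-empty compact subsets of some neighborhood of `x`. -/
theorem SmythPowerdomain.exists_nhds_forall_mem_of_isOpen [T2Space X] [FirstCountableTopology X]
    {V : Set (WithScott (SmythPowerdomain X))} (hV : IsOpen V) {x : X}
    (hx : WithScott.toScott (ofIsCompact {x} (singleton_nonempty x) isCompact_singleton) ∈ V) :
    ∃ U ∈ 𝓝 x, ∀ K : SmythPowerdomain X, K.carrier ⊆ U → WithScott.toScott K ∈ V := by
  rw [IsScott.isOpen_iff_isUpperSet_and_dirSupInaccOn (D := univ), dirSupInaccOn_univ] at hV
  obtain ⟨hup, hinacc⟩ := hV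
  obtain ⟨B, hB⟩ := (𝓝 x).exists_antitone_basis
  by_contra! hcon
  -- The tails of the bad sequence `K`, with `x` added, are compact and shrink to `{x}`. Some tail
  -- is thus in `V`, and so is each `K m` inside it.
  choose K hKB hKV using fun n ↦ hcon (B n) (hB.1.mem_of_mem trivial)
  have hc (n : ℕ) : IsCompact (insert x (⋃ m, (K (n + m)).carrier)) := by
    refine isCompact_insert_iUnion_of_tendsto (fun m ↦ (K (n + m)).isCompact) fun U hU ↦ ?_
    obtain ⟨N, -, hN⟩ := hB.1.mem_iff.1 hU
    exact ⟨N, fun m hm ↦ (hKB _).trans ((hB.2 (by omega)).trans hN)⟩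
  let L (n : ℕ) : WithScott (SmythPowerdomain X) :=
    WithScott.toScott (ofIsCompact _ (insert_nonempty _ _) (hc n))
  have hLK (n m : ℕ) (h : n ≤ m) : L n ≤ WithScott.toScott (K m) := fun y hy ↦
    mem_insert_of_mem _ (mem_iUnion.2 ⟨m - n, by rwa [Nat.add_sub_cancel' h]⟩)
  have hmono : Monotone L := fun n m hnm y hy ↦ by
    rcases hy with rfl | hy
    · exact mem_insert _ _
    · obtain ⟨k, hk⟩ := mem_iUnion.1 hy
      exact hLK n (m + k) (by omega) hk
  have hlub : IsLUB (range L)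
      (WithScott.toScott (ofIsCompact {x} (singleton_nonempty x) isCompact_singleton)) := by
    refine ⟨?_, fun M hM y hy ↦ ?_⟩
    · rintro _ ⟨n, rfl⟩
      exact singleton_subset_iff.2 (mem_insert _ _)
    · by_contra hyx
      obtain ⟨N, -, hN⟩ := hB.1.mem_iff.1 (isOpen_compl_singleton.mem_nhds (Ne.symm hyx : x ≠ y))
      rcases hM (mem_range_self N) hy with rfl | h
      · exact hyx rfl
      · obtain ⟨k, hk⟩ := mem_iUnion.1 h
        exact hN (hB.2 (by omega) (hKB _ hk)) rfl
  obtain ⟨_, ⟨n, rfl⟩, hn⟩ := hinacc (range_nonempty L)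
    (directedOn_range.2 hmono.directed_le) hlub hx
  exact hKV n (hup (hLK n n le_rfl) hn)

/-- If the Smyth powerdomain of a first-countable Hausdorff space is core-compact in its Scott
topology, then every point of the space has a compact neighborhood. -/
theorem weaklyLocallyCompactSpace_of_isCoreCompactSpace_smythPowerdomain [T2Space X]
    [FirstCountableTopology X] (h : IsCoreCompactSpace (WithScott (SmythPowerdomain X))) :
    WeaklyLocallyCompactSpace X := by
  refine ⟨fun x ↦ ?_⟩
  obtain ⟨V, hVo, hxV, hV⟩ := h
    (WithScott.toScott (.ofIsCompact {x} (singleton_nonempty x) isCompact_singleton)) univ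
    isOpen_univ trivial
  obtain ⟨U, hU, hUV⟩ := SmythPowerdomain.exists_nhds_forall_mem_of_isOpen hVo hxV
  by_contra! hcon
  let box (y : X) : Set (WithScott (SmythPowerdomain X)) :=
    {K | (WithScott.ofScott K).carrier ⊆ {y}ᶜ}
  obtain ⟨F, hFC, hF, hVF⟩ := hV (box '' U)
    (by
      rintro _ ⟨y, -, rfl⟩
      exact SmythPowerdomain.isOpen_setOf_carrier_subset isOpen_compl_singleton)
    (fun K _ ↦ by
      have hK : ¬ U ⊆ (WithScott.ofScott K).carrier := fun hUK ↦
        hcon _ (WithScott.ofScott K).isCompact (mem_of_superset hU hUK)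
      obtain ⟨y, hyU, hyK⟩ := not_subset.1 hK
      exact ⟨box y, mem_image_of_mem _ hyU, subset_compl_singleton_iff.2 hyK⟩)
  obtain ⟨T, hTU, hT, hVF⟩ :=
    (exists_subset_image_finite_and (p := (V ⊆ ⋃₀ ·))).1 ⟨F, hFC, hF, hVF⟩
  -- Adding `x` keeps the set non-empty even if `T` is empty.
  obtain ⟨_, ⟨y, hyT, rfl⟩, hy⟩ := hVF (hUV
    (.ofIsCompact (insert x T) (insert_nonempty _ _) (hT.insert x).isCompact)
    (insert_subset (mem_of_mem_nhds hU) hTU))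
  exact hy (mem_insert_of_mem _ hyT) rfl

end Smyth

namespace SorgenfreyLine

/-- The identity from the Sorgenfrey line to the real line. -/
def toReal (x : SorgenfreyLine) : ℝ := x

theorem isOpen_Ico (a b : ℝ) : IsOpen (toReal ⁻¹' Ico a b) := by
  rcases lt_or_ge a b with h | h
  · exact TopologicalSpace.isOpen_generateFrom_of_mem ⟨a, b, h, rfl⟩
  · simp [Ico_eq_empty_of_le h]

theorem exists_Ico_subset_of_isOpen {U : Set SorgenfreyLine} (hU : IsOpen U) :
    ∀ x ∈ U, ∃ b > toReal x, toReal ⁻¹' Ico (toReal x) b ⊆ U := by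
  induction hU with
  | basic s hs =>
    obtain ⟨a, b, -, rfl⟩ := hs
    exact fun x hx ↦ ⟨b, hx.2, fun y hy ↦ ⟨hx.1.trans hy.1, hy.2⟩⟩
  | univ => exact fun x _ ↦ ⟨toReal x + 1, lt_add_one _, subset_univ _⟩
  | inter s t _ _ hs ht =>
    intro x hx
    obtain ⟨b, hb, hbs⟩ := hs x hx.1
    obtain ⟨c, hc, hct⟩ := ht x hx.2
    exact ⟨min b c, lt_min hb hc, fun y hy ↦
      ⟨hbs ⟨hy.1, hy.2.trans_le (min_le_left _ _)⟩, hct ⟨hy.1, hy.2.trans_le (min_le_right _ _)⟩⟩⟩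
  | sUnion S _ hS =>
    rintro x ⟨s, hs, hxs⟩
    obtain ⟨b, hb, hbs⟩ := hS s hs x hxs
    exact ⟨b, hb, hbs.trans (subset_sUnion_of_mem hs)⟩

theorem exists_Ico_subset_of_mem_nhds {x : SorgenfreyLine} {U : Set SorgenfreyLine}
    (hU : U ∈ 𝓝 x) : ∃ b > toReal x, toReal ⁻¹' Ico (toReal x) b ⊆ U := by
  obtain ⟨W, hWU, hW, hxW⟩ := mem_nhds_iff.1 hU
  obtain ⟨b, hb, hbW⟩ := exists_Ico_subset_of_isOpen hW x hxW
  exact ⟨b, hb, hbW.trans hWU⟩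

theorem hasBasis_nhds (x : SorgenfreyLine) :
    (𝓝 x).HasBasis (fun _ : ℕ ↦ True)
      fun n ↦ toReal ⁻¹' Ico (toReal x) (toReal x + 1 / (n + 1)) := by
  refine ⟨fun U ↦ ⟨fun hU ↦ ?_, ?_⟩⟩
  · obtain ⟨b, hb, hbU⟩ := exists_Ico_subset_of_mem_nhds hU
    obtain ⟨n, hn⟩ := exists_nat_one_div_lt (sub_pos.2 hb)
    exact ⟨n, trivial, fun y hy ↦ hbU ⟨hy.1, hy.2.trans (by linarith)⟩⟩
  · rintro ⟨n, -, hn⟩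
    exact mem_of_superset ((isOpen_Ico _ _).mem_nhds
      ⟨le_rfl, lt_add_of_pos_right _ Nat.one_div_pos_of_nat⟩) hn

instance : FirstCountableTopology SorgenfreyLine :=
  ⟨fun x ↦ (hasBasis_nhds x).isCountablyGenerated⟩

theorem continuous_toReal : Continuous toReal := by
  refine continuous_iff_continuousAt.2 fun x U hU ↦ ?_
  obtain ⟨a, b, hx, hab⟩ := mem_nhds_iff_exists_Ioo_subset.1 hU
  exact mem_of_superset ((isOpen_Ico (toReal x) b).mem_nhds ⟨le_rfl, hx.2⟩)
    fun y hy ↦ hab ⟨hx.1.trans_le hy.1, hy.2⟩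

instance : T2Space SorgenfreyLine :=
  .of_injective_continuous (f := toReal) (fun _ _ h ↦ h) continuous_toReal

theorem isClosed_Ico (a b : ℝ) : IsClosed (toReal ⁻¹' Ico a b) := by
  refine isOpen_compl_iff.1 (isOpen_iff_mem_nhds.2 fun x hx ↦ ?_)
  rcases lt_or_ge (toReal x) a with h | h
  · exact mem_of_superset ((isOpen_Ico (toReal x) a).mem_nhds ⟨le_rfl, h⟩)
      fun y hy hy' ↦ hy.2.not_ge hy'.1
  · exact mem_of_superset
      ((isOpen_Ico (toReal x) (toReal x + 1)).mem_nhds ⟨le_rfl, lt_add_one _⟩)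
      fun y hy hy' ↦ hx ⟨h, hy.1.trans_lt hy'.2⟩

/-- Compactness would pass to the usual topology of `ℝ`, where the interval is not closed. -/
theorem not_isCompact_Ico {a b : ℝ} (h : a < b) : ¬ IsCompact (toReal ⁻¹' Ico a b) := by
  intro hc
  have him : toReal '' (toReal ⁻¹' Ico a b) = Ico a b :=
    image_preimage_eq _ fun x ↦ ⟨x, rfl⟩
  have hcl : IsClosed (Ico a b) := him ▸ (hc.image continuous_toReal).isClosed
  have hb : b ∈ Ico a b := by
    rw [← hcl.closure_eq, closure_Ico h.ne]
    exact right_mem_Icc.2 h.le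
  exact lt_irrefl b hb.2

theorem not_weaklyLocallyCompactSpace : ¬ WeaklyLocallyCompactSpace SorgenfreyLine := by
  intro h
  obtain ⟨K, hK, hKx⟩ := h.exists_compact_mem_nhds (show SorgenfreyLine from (0 : ℝ))
  obtain ⟨b, hb, hbK⟩ := exists_Ico_subset_of_mem_nhds hKx
  exact not_isCompact_Ico hb (hK.of_isClosed_subset (isClosed_Ico _ _) hbK)

end SorgenfreyLine

theorem mainTheorem12 :
    ¬ IsCoreCompactSpace (Topology.WithScott (SmythPowerdomain SorgenfreyLine)) := fun h ↦
  SorgenfreyLine.not_weaklyLocallyCompactSpace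
    (weaklyLocallyCompactSpace_of_isCoreCompactSpace_smythPowerdomain h)
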